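/- Proposition 5.9. Let $\nu$ be a lattice path with finitely many north and east unit steps, let $F_\nu$ be the Ferrers diagram weakly above $\nu$ in the smallest rectangle containing $\nu$, and let $A_\nu$ be the set of lattice points of $F_\nu$ (weakly above $\nu$). Rows are numbered from top to bottom and columns from left to right, starting with $1$; $(i,j)$ is the lattice point in row $i$ and column $j$. Two points $p,q\in A_\nu$ are $\nu$-incompatible if one of them is strictly southwest of the other and the smallest rectangle containing both lies in $F_\nu$. A $\nu$-tree is a maximal set of pairwise $\nu$-compatible points of $A_\nu$. A $\nu$-path is a lattice path with the same endpoints as $\nu$ that is weakly above $\nu$. Left flushing. Given a $\nu$-tree $T$, process its rows from bottom to top, and the points of each row from right to left: each point is moved, within its row, to the leftmost column that is not already occupied by a moved point of that row and not forbidden by a previous row; the columns forbidden by a row are those of its moved points except the last (rightmost) one. The moved points are the lattice points of a unique $\nu$-path $\mathsf{left}(T)$. Edelman–Greene path. For a $\nu$-tree $T$, read the pairs $\binom{i}{i+j-1}$ for the points $(i,j)\in A_\nu\smallsetminus T$ row by row from top to bottom, and from right to left in each row. Insert the bottom letters successively into an initially empty tableau by column Edelman–Greene insertion, starting with the first column,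 and record each top letter in the newly created box of the recording tableau $\mathsf{Y}(T)$. Here, inserting a letter $i$ into a column appends $i$ to it if all its entries are $\le i$; otherwise, if it contains both $i$ and $i+1$, it is unchanged and $i+1$ is inserted into the next column; otherwise, its smallest entry $j>i$ is replaced by $i$, and $j$ is inserted into the next column. There is a unique $\nu$-path $\mathsf{EG}(T)$ such that the boxes weakly above it are precisely the boxes of $\mathsf{Y}(T)$ whose label equals their row number. Then, for every lattice path $\nu$ and every $\nu$-tree $T$, both paths are well defined, and $$\mathsf{EG}(T)=\mathsf{left}(T).$$ -/

import Mathlib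

namespace NuTree

/-- A unit step of a lattice path: north or east. -/
inductive Step where
  | N : Step
  | E : Step
  deriving DecidableEq

/-- A lattice path is the word of its steps, read from southwest to northeast.  Lattice points are
written in matrix coordinates `(i, j)` counted from `0`: `i` is the row, counted from top to bottom,
and `j` is the column, counted from left to right.  The path `μ` runs from the bottom left corner
`(μ.count N, 0)` to the top right corner `(0, μ.count E)` of its bounding rectangle. -/
abbrev LatticePath := List Step

/-- The lattice points on the path `μ`.  After `t` steps, the column is the number of east steps
already made and the row is the number of north steps still to be made. -/
def LatticePath.points (μ : LatticePath) : Finset (ℕ × ℕ) :=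
  (Finset.range (μ.length + 1)).image
    (fun t => ((μ.drop t).count Step.N, (μ.take t).count Step.E))

/-- `A_μ`: the lattice points of the bounding rectangle of `μ` that lie weakly above `μ`
(equivalently, weakly to the left of `μ`), points of `μ` included. -/
def LatticePath.above (μ : LatticePath) : Finset (ℕ × ℕ) :=
  (Finset.range (μ.count Step.N + 1) ×ˢ Finset.range (μ.count Step.E + 1)).filter
    (fun p => ∃ q ∈ μ.points, q.1 = p.1 ∧ p.2 ≤ q.2)

/-- `F_μ`: the boxes of the Ferrers diagram weakly above `μ`.  The box `(k, c)` is the unit square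
with northwest corner `(k, c)` and southeast corner `(k + 1, c + 1)`; it is weakly above `μ` exactly
when its southeast corner is. -/
def LatticePath.IsBoxAbove (μ : LatticePath) (k c : ℕ) : Prop :=
  (k + 1, c + 1) ∈ μ.above

/-- `μ` is a `ν`-path: it has the same endpoints as `ν` and is weakly above `ν`. -/
def IsNuPath (ν μ : LatticePath) : Prop :=
  μ.count Step.N = ν.count Step.N ∧ μ.count Step.E = ν.count Step.E ∧ μ.points ⊆ ν.above

/-- `p` is (strictly) southwest of `q`, and all lattice points of the smallest rectangle containing
`p` and `q` belong to `A_ν`; that is, the rectangle lies inside the Ferrers diagram of `ν`. -/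
def IsIncompatibleSW (ν : LatticePath) (p q : ℕ × ℕ) : Prop :=
  q.1 < p.1 ∧ p.2 < q.2 ∧
    ∀ i j : ℕ, q.1 ≤ i → i ≤ p.1 → p.2 ≤ j → j ≤ q.2 → (i, j) ∈ ν.above

/-- `ν`-incompatibility of two lattice points. -/
def IsIncompatible (ν : LatticePath) (p q : ℕ × ℕ) : Prop :=
  IsIncompatibleSW ν p q ∨ IsIncompatibleSW ν q p

/-- A `ν`-tree: a maximal set of pairwise `ν`-compatible points of `A_ν`. -/
def IsNuTree (ν : LatticePath) (T : Finset (ℕ × ℕ)) : Prop :=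
  Maximal (fun S : Finset (ℕ × ℕ) =>
    S ⊆ ν.above ∧ ∀ p ∈ S, ∀ q ∈ S, ¬ IsIncompatible ν p q) T

/-! ### Left flushing -/

/-- Place `n` points of one row one after the other, each in the leftmost column that is neither
in `F` nor already occupied.  The result lists their columns in the order of placement. -/
def placeRow : Finset ℕ → ℕ → List ℕ
  | _, 0 => []
  | F, n + 1 =>
    let c := Nat.find (Infinite.exists_notMem_finset F)
    c :: placeRow (insert c F) n

/-- Left-flush the listed rows of `T`, one after the other, where the columns in `F` are forbidden
at the start.  Each row then forbids the columns of its flushed points, excepting the last one. -/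
def flushRows (T : Finset (ℕ × ℕ)) : List ℕ → Finset ℕ → Finset (ℕ × ℕ)
  | [], _ => ∅
  | i :: rows, F =>
    let P := placeRow F (T.filter (fun p => p.1 = i)).card
    P.toFinset.image (fun j => (i, j)) ∪ flushRows T rows (F ∪ P.dropLast.toFinset)

/-- The collection of lattice points obtained by left-flushing `T`, from the bottom row to the top
row, with no forbidden columns at the start. -/
def leftFlush (ν : LatticePath) (T : Finset (ℕ × ℕ)) : Finset (ℕ × ℕ) :=
  flushRows T (List.range (ν.count Step.N + 1)).reverse ∅

/-- `μ` is the `ν`-path formed by the points of the left flushing of `T`. -/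
def IsLeftFlushingPath (ν : LatticePath) (T : Finset (ℕ × ℕ)) (μ : LatticePath) : Prop :=
  IsNuPath ν μ ∧ μ.points = leftFlush ν T

/-! ### The column Edelman-Greene correspondence -/

/-- Edelman-Greene insertion of the letter `i` into one column (listed from top to bottom).  The
result is the new column, together with the letter bumped to the next column, if there is one. -/
def insertColumn (i : ℕ) (C : List ℕ) : List ℕ × Option ℕ :=
  match (C.filter (fun a => i < a)).min? with
  | none => (C ++ [i], none)
  | some j => if i ∈ C ∧ i + 1 ∈ C then (C, some (i + 1)) else (C.replace j i, some j)

/-- Edelman-Greene insertion of the letter `i` into a tableau, which is given by the list of its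
columns from left to right.  The result is the new tableau, together with the index (from `0`) of
the column at whose end the new box was created. -/
def insertTableau : ℕ → List (List ℕ) → List (List ℕ) × ℕ
  | i, [] => ([[i]], 0)
  | i, C :: Cs =>
    match insertColumn i C with
    | (C', none) => (C' :: Cs, 0)
    | (C', some j) => (C' :: (insertTableau j Cs).1, (insertTableau j Cs).2 + 1)

/-- The reading biword of `T`: the columns `(i, i + j - 1)` of the biword, for the points of
`A_ν \ T` with coordinates `(i, j)` counted from `1`, read row by row from top to bottom and from
right to left in each row. -/
def readingBiword (ν : LatticePath) (T : Finset (ℕ × ℕ)) : List (ℕ × ℕ) :=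
  (List.range (ν.count Step.N + 1)).flatMap (fun i =>
    ((List.range (ν.count Step.E + 1)).reverse.filter (fun j => (i, j) ∈ ν.above \ T)).map
      (fun j => (i + 1, i + j + 1)))

/-- The pair of the insertion tableau (the list of its columns) and the recording tableau (the
function that maps `c` to the column with index `c`, the empty list if there is none) of a biword:
the bottom letters are inserted, and each top letter is recorded in the newly created box. -/
def edelmanGreene (w : List (ℕ × ℕ)) : List (List ℕ) × (ℕ → List ℕ) :=
  w.foldl (fun XY ab =>
    ((insertTableau ab.2 XY.1).1,
      Function.update XY.2 (insertTableau ab.2 XY.1).2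
        (XY.2 (insertTableau ab.2 XY.1).2 ++ [ab.1])))
    ([], fun _ => [])

/-- The label of the box `(k, c)` (counted from `0`) in the recording tableau of `T`, if that
tableau has such a box. -/
def recordingLabel (ν : LatticePath) (T : Finset (ℕ × ℕ)) (k c : ℕ) : Option ℕ :=
  ((edelmanGreene (readingBiword ν T)).2 c)[k]?

/-- `μ` is the `ν`-path such that the boxes weakly above it are precisely the boxes of the recording
tableau of `T` whose label is their row number (counted from `1`). -/
def IsEdelmanGreenePath (ν : LatticePath) (T : Finset (ℕ × ℕ)) (μ : LatticePath) : Prop :=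
  IsNuPath ν μ ∧ ∀ k c : ℕ, μ.IsBoxAbove k c ↔ recordingLabel ν T k c = some (k + 1)

end NuTree

/-!
Let `T` be a `ν`-tree with `n i` points in row `i`.  Both paths are identified with the path that
makes `n i - 1` east steps in row `i`, so that it reaches the column `m i = ∑_{x ≥ i} (n x - 1)`
in row `i`.

*The rows of a `ν`-tree.*  Call a column blocked by the rows `≥ k` if in one of these rows it
contains a point of `T` other than the leftmost point of the row, and let `G k` be the set of these
columns (`blocked`).  Maximality and compatibility of `T` say that row `k` consists of all columns
from some column `t` to the end of the row that are not in `G (k + 1)` (`IsNuTree.row_structure`).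
Hence `G k` is the disjoint union of `G (k + 1)` and the columns of all points of `T` in row `k` but the
first one, its size is `m k`, and in row `0` all columns except `0` are blocked, which gives the right endpoint.

*Left flushing.*  The columns forbidden by the flushed rows below row `i` form the interval
`[0, m (i + 1))`, so the flushed points of row `i` fill the columns from `m (i + 1)` to `m i`.

*Edelman–Greene insertion.*  Boxes in row `k` with label `k + 1` (rows counted from `0`) arise
exactly when a column of the tableau reaches length `k + 1` with the letters of row `k`, that is,
when it grows with every row up to row `k`.  There are exactly `m (k + 1)` such columns, by an
explicit description of the insertion tableau before row `k` (`ColumnState`): the column with index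
`c < m k` has length `k` and last entry `g + k`, where `g` is the `c`-th element of `G k`, and all
other columns are shorter and have small entries.  The induction step (`ColumnState.row_step`)
follows the letters of row `k` from column to column.  They come from the columns in `G (k + 1)` and
from the free columns left of `t`.  The letter of the `c`-th element of `G (k + 1)` is appended to
the column with index `c`, the letters to its right pass unchanged, and the letters of the free
columns to its left, which form an interval, move up by one
(`columnPass_active`, `columnPass_active_special`).
-/

namespace NuTree

/-! ### Lattice paths as sequences of horizontal runs -/

/-- The lattice path with rows `a, a - 1, …, 0` (from bottom to top) that makes `d i` east steps in
row `i`. -/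
def rowPath (d : ℕ → ℕ) : ℕ → LatticePath
  | 0 => List.replicate (d 0) Step.E
  | a + 1 => List.replicate (d (a + 1)) Step.E ++ Step.N :: rowPath d a

/-- The rightmost column that `rowPath d a` reaches in row `i`. -/
def rowEnd (d : ℕ → ℕ) (a i : ℕ) : ℕ := ∑ x ∈ Finset.Icc i a, d x

theorem rowEnd_anti (d : ℕ → ℕ) (a : ℕ) {i j : ℕ} (h : i ≤ j) : rowEnd d a j ≤ rowEnd d a i :=
  Finset.sum_le_sum_of_subset (Finset.Icc_subset_Icc_left h)

theorem rowEnd_eq_add (d : ℕ → ℕ) {a i : ℕ} (h : i ≤ a) :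
    rowEnd d a i = d i + rowEnd d a (i + 1) := by
  rw [rowEnd, rowEnd, Finset.Icc_eq_cons_Ioc h, Finset.sum_cons, Finset.Icc_add_one_left_eq_Ioc]

theorem rowEnd_succ_right (d : ℕ → ℕ) {a i : ℕ} (h : i ≤ a + 1) :
    rowEnd d (a + 1) i = rowEnd d a i + d (a + 1) :=
  Finset.sum_Icc_succ_top h d

theorem rowEnd_of_lt (d : ℕ → ℕ) {a i : ℕ} (h : a < i) : rowEnd d a i = 0 := by
  simp [rowEnd, Finset.Icc_eq_empty_of_lt h]

theorem count_N_rowPath (d : ℕ → ℕ) (a : ℕ) : (rowPath d a).count Step.N = a := by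
  induction a with
  | zero => simp [rowPath, List.count_replicate]
  | succ a ih => simp [rowPath, List.count_replicate, ih]

theorem count_E_rowPath (d : ℕ → ℕ) (a : ℕ) : (rowPath d a).count Step.E = rowEnd d a 0 := by
  induction a with
  | zero => simp [rowPath, rowEnd]
  | succ a ih =>
    rw [rowEnd_succ_right d (Nat.zero_le _)]
    simp [rowPath, ih, add_comm]

theorem rowPath_congr {d d' : ℕ → ℕ} {a : ℕ} (h : ∀ i ≤ a, d i = d' i) :
    rowPath d a = rowPath d' a := by
  induction a with
  | zero => simp [rowPath, h]
  | succ a ih => simp [rowPath, h (a + 1) le_rfl, ih (fun i hi => h i (by omega))]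

theorem exists_rowPath (μ : LatticePath) : ∃ d, rowPath d (μ.count Step.N) = μ := by
  induction μ with
  | nil => exact ⟨fun _ => 0, rfl⟩
  | cons s μ ih =>
    obtain ⟨d, hd⟩ := ih
    cases s with
    | N =>
      refine ⟨Function.update d (μ.count Step.N + 1) 0, ?_⟩
      have := rowPath_congr (d := Function.update d (μ.count Step.N + 1) 0) (d' := d)
        (a := μ.count Step.N) (fun i hi => Function.update_of_ne (by omega) _ _)
      simp [rowPath, this, hd]
    | E =>
      refine ⟨Function.update d (μ.count Step.N) (d (μ.count Step.N) + 1), ?_⟩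
      rw [List.count_cons_of_ne (by decide)]
      generalize μ.count Step.N = a at hd
      cases a with
      | zero => simp [rowPath, List.replicate_succ, ← hd]
      | succ a =>
        have := rowPath_congr (d := Function.update d (a + 1) (d (a + 1) + 1)) (d' := d)
          (a := a) (fun i hi => Function.update_of_ne (by omega) _ _)
        simp [rowPath, List.replicate_succ, ← hd, this]

theorem mem_points_nil {i j : ℕ} : (i, j) ∈ LatticePath.points [] ↔ i = 0 ∧ j = 0 := by
  simp [LatticePath.points]

theorem mem_points_cons (s : Step) (μ : LatticePath) {i j : ℕ} :
    (i, j) ∈ LatticePath.points (s :: μ) ↔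
      (i = (s :: μ).count Step.N ∧ j = 0) ∨
        ∃ q ∈ μ.points, i = q.1 ∧ j = [s].count Step.E + q.2 := by
  simp only [LatticePath.points, Finset.mem_image, Finset.mem_range, Prod.mk.injEq]
  constructor
  · rintro ⟨t, ht, h1, h2⟩
    cases t with
    | zero => left; simpa [eq_comm] using And.intro h1 h2
    | succ t =>
      refine Or.inr ⟨_, ⟨t, by simpa using ht, rfl⟩, by simpa using h1.symm, ?_⟩
      rw [← h2, List.take_succ_cons, ← List.singleton_append, List.count_append]
  · rintro (⟨h1, h2⟩ | ⟨_, ⟨t, ht, rfl⟩, h1, h2⟩)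
    · exact ⟨0, by simp, by simp [h1], by simp [h2]⟩
    · refine ⟨t + 1, by simpa using ht, by simpa using h1.symm, ?_⟩
      rw [h2, List.take_succ_cons, ← List.singleton_append, List.count_append]

theorem mem_points_N (μ : LatticePath) {i j : ℕ} :
    (i, j) ∈ LatticePath.points (Step.N :: μ) ↔
      (i = μ.count Step.N + 1 ∧ j = 0) ∨ (i, j) ∈ μ.points := by
  rw [mem_points_cons]
  refine or_congr (by simp) ⟨?_, fun h => ⟨_, h, rfl, by simp⟩⟩
  rintro ⟨⟨x, y⟩, h, rfl, rfl⟩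
  simpa using h

theorem mem_points_replicate_append (n : ℕ) (μ : LatticePath) (h0 : (μ.count Step.N, 0) ∈ μ.points)
    {i j : ℕ} :
    (i, j) ∈ LatticePath.points (List.replicate n Step.E ++ μ) ↔
      (i = μ.count Step.N ∧ j ≤ n) ∨ (n ≤ j ∧ (i, j - n) ∈ μ.points) := by
  induction n generalizing j with
  | zero =>
    simp only [List.replicate_zero, List.nil_append, Nat.le_zero, Nat.zero_le, true_and,
      Nat.sub_zero]
    refine ⟨Or.inr, ?_⟩
    rintro (⟨rfl, rfl⟩ | h)
    exacts [h0, h]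
  | succ n ih =>
    rw [List.replicate_succ, List.cons_append, mem_points_cons]
    have hc : (Step.E :: (List.replicate n Step.E ++ μ)).count Step.N = μ.count Step.N := by
      simp [List.count_replicate]
    rw [hc]
    constructor
    · rintro (⟨h1, h2⟩ | ⟨⟨x, y⟩, hq, h1, h2⟩)
      · exact Or.inl ⟨h1, by omega⟩
      · simp only [List.count_singleton_self] at h1 h2
        subst h1 h2
        rcases ih.1 hq with ⟨h1, h2⟩ | ⟨h1, h2⟩
        · exact Or.inl ⟨h1, by omega⟩
        · exact Or.inr ⟨by omega, by rwa [show 1 + y - (n + 1) = y - n by omega]⟩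
    · intro h
      rcases Nat.eq_zero_or_pos j with rfl | hj
      · rcases h with ⟨h1, h2⟩ | ⟨h1, h2⟩
        · exact Or.inl ⟨h1, rfl⟩
        · omega
      · refine Or.inr ⟨(i, j - 1), ih.2 ?_, rfl, ?_⟩
        · rcases h with ⟨h1, h2⟩ | ⟨h1, h2⟩
          · exact Or.inl ⟨h1, by omega⟩
          · exact Or.inr ⟨by omega, by rwa [show j - 1 - n = j - (n + 1) by omega]⟩
        · simp only [List.count_singleton_self]; omega

/-- In row `i`, the path fills the columns between its end in the row below and its end in row `i`. -/
theorem mem_points_rowPath (d : ℕ → ℕ) (a : ℕ) {i j : ℕ} :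
    (i, j) ∈ LatticePath.points (rowPath d a) ↔
      i ≤ a ∧ rowEnd d a (i + 1) ≤ j ∧ j ≤ rowEnd d a i := by
  induction a generalizing i j with
  | zero =>
    have := mem_points_replicate_append (d 0) [] (by simp [mem_points_nil]) (i := i) (j := j)
    rw [List.append_nil] at this
    rw [rowPath, this, mem_points_nil, rowEnd_of_lt _ (Nat.succ_pos i)]
    simp only [List.count_nil]
    constructor
    · rintro (⟨rfl, h⟩ | ⟨h, rfl, h'⟩) <;> refine ⟨le_rfl, Nat.zero_le _, ?_⟩ <;> simp [rowEnd]
        <;> omega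
    · rintro ⟨h1, -, h2⟩
      obtain rfl := Nat.le_zero.1 h1
      simp only [rowEnd, Finset.Icc_self, Finset.sum_singleton] at h2
      exact Or.inl ⟨rfl, h2⟩
  | succ a ih =>
    have hN : (Step.N :: rowPath d a).count Step.N = a + 1 := by simp [count_N_rowPath]
    rw [rowPath, mem_points_replicate_append, hN, mem_points_N, ih, count_N_rowPath]
    · rcases Nat.lt_or_ge a i with hi | hi
      · rcases Nat.lt_or_ge (a + 1) i with hi' | hi'
        · constructor
          · rintro (h | ⟨h1, h | h⟩) <;> omega
          · omega
        · obtain rfl : i = a + 1 := by omega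
          rw [rowEnd_of_lt d (Nat.lt_succ_self (a + 1)), rowEnd_succ_right d le_rfl,
            rowEnd_of_lt d (Nat.lt_succ_self a)]
          constructor
          · rintro (h | ⟨h1, h | h⟩) <;> omega
          · omega
      · rw [rowEnd_succ_right d (show i + 1 ≤ a + 1 by omega),
          rowEnd_succ_right d (show i ≤ a + 1 by omega)]
        constructor
        · rintro (h | ⟨h1, h | h⟩) <;> omega
        · omega
    · rw [mem_points_N]; simp

theorem mem_above_rowPath (d : ℕ → ℕ) (a : ℕ) {i j : ℕ} :
    (i, j) ∈ LatticePath.above (rowPath d a) ↔ i ≤ a ∧ j ≤ rowEnd d a i := by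
  simp only [LatticePath.above, Finset.mem_filter, Finset.mem_product, Finset.mem_range,
    count_N_rowPath, count_E_rowPath]
  constructor
  · rintro ⟨⟨h1, -⟩, ⟨x, y⟩, hq, rfl, h2⟩
    exact ⟨by omega, h2.trans ((mem_points_rowPath d a).1 hq).2.2⟩
  · rintro ⟨h1, h2⟩
    have := rowEnd_anti d a (Nat.zero_le i)
    exact ⟨⟨by omega, by omega⟩, (i, rowEnd d a i),
      (mem_points_rowPath d a).2 ⟨h1, rowEnd_anti d a (Nat.le_succ i), le_rfl⟩, rfl, h2⟩

theorem eq_of_mem_above_iff {μ μ' : LatticePath} (hN : μ.count Step.N = μ'.count Step.N)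
    (h : ∀ i j, (i, j) ∈ μ.above ↔ (i, j) ∈ μ'.above) : μ = μ' := by
  obtain ⟨d, hd⟩ := exists_rowPath μ
  obtain ⟨d', hd'⟩ := exists_rowPath μ'
  rw [← hN] at hd'
  generalize μ.count Step.N = a at hd hd'
  subst hd hd'
  have key : ∀ i, rowEnd d a i = rowEnd d' a i := fun i => by
    rcases Nat.lt_or_ge a i with hi | hi
    · rw [rowEnd_of_lt d hi, rowEnd_of_lt d' hi]
    · simp only [mem_above_rowPath] at h
      exact le_antisymm ((h i _).1 ⟨hi, le_rfl⟩).2 ((h i _).2 ⟨hi, le_rfl⟩).2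
  refine rowPath_congr fun i hi => ?_
  have h1 := rowEnd_eq_add d hi
  have h2 := rowEnd_eq_add d' hi
  rw [key, key] at h1
  omega

theorem zero_left_mem_above (μ : LatticePath) {j : ℕ} :
    (0, j) ∈ μ.above ↔ j ≤ μ.count Step.E := by
  obtain ⟨d, hd⟩ := exists_rowPath μ
  generalize μ.count Step.N = a at hd
  subst hd
  simp [mem_above_rowPath, count_E_rowPath]

theorem zero_right_mem_above (μ : LatticePath) {i : ℕ} :
    (i, 0) ∈ μ.above ↔ i ≤ μ.count Step.N := by
  obtain ⟨d, hd⟩ := exists_rowPath μ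
  generalize μ.count Step.N = a at hd
  subst hd
  simp [mem_above_rowPath]

theorem eq_of_isBoxAbove_iff {μ μ' : LatticePath} (hN : μ.count Step.N = μ'.count Step.N)
    (hE : μ.count Step.E = μ'.count Step.E)
    (h : ∀ k c, μ.IsBoxAbove k c ↔ μ'.IsBoxAbove k c) : μ = μ' := by
  refine eq_of_mem_above_iff hN fun i j => ?_
  rcases i with _ | k
  · rw [zero_left_mem_above, zero_left_mem_above, hE]
  · rcases j with _ | c
    · rw [zero_right_mem_above, zero_right_mem_above, hN]
    · exact h k c

theorem eq_of_points_eq {μ μ' : LatticePath} (hN : μ.count Step.N = μ'.count Step.N)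
    (hE : μ.count Step.E = μ'.count Step.E) (h : μ.points = μ'.points) : μ = μ' :=
  eq_of_mem_above_iff hN fun i j => by rw [LatticePath.above, LatticePath.above, hN, hE, h]

/-! ### The rows of a `ν`-tree -/

/-- The columns that contain, in some row `i ≥ k` of `T`, a point of `T` that is not the leftmost
point of its row. -/
def blocked (T : Finset (ℕ × ℕ)) (k : ℕ) : Finset ℕ :=
  (T.filter fun p => k ≤ p.1 ∧ ∃ c ∈ Finset.range p.2, (p.1, c) ∈ T).image Prod.snd

theorem mem_blocked {T : Finset (ℕ × ℕ)} {k j : ℕ} :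
    j ∈ blocked T k ↔ ∃ i, k ≤ i ∧ (i, j) ∈ T ∧ ∃ c < j, (i, c) ∈ T := by
  simp only [blocked, Finset.mem_image, Finset.mem_filter, Finset.mem_range, Prod.exists,
    exists_eq_right]
  exact exists_congr fun i => by tauto

theorem blocked_anti (T : Finset (ℕ × ℕ)) {k l : ℕ} (h : k ≤ l) : blocked T l ⊆ blocked T k := by
  intro j hj
  obtain ⟨i, hi, h'⟩ := mem_blocked.1 hj
  exact mem_blocked.2 ⟨i, h.trans hi, h'⟩

theorem pos_of_mem_blocked {T : Finset (ℕ × ℕ)} {k j : ℕ} (h : j ∈ blocked T k) : 0 < j := by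
  obtain ⟨_, _, _, c, hc, _⟩ := mem_blocked.1 h
  omega

/-- The number of points of `T` in row `i`. -/
def rowCard (T : Finset (ℕ × ℕ)) (i : ℕ) : ℕ := (T.filter fun p => p.1 = i).card

section Tree

variable {d : ℕ → ℕ} {a : ℕ} {T : Finset (ℕ × ℕ)}

theorem isIncompatibleSW_rowPath {i j k l : ℕ} :
    IsIncompatibleSW (rowPath d a) (i, j) (k, l) ↔
      k < i ∧ j < l ∧ i ≤ a ∧ l ≤ rowEnd d a i := by
  simp only [IsIncompatibleSW, mem_above_rowPath]
  constructor
  · rintro ⟨h1, h2, h3⟩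
    exact ⟨h1, h2, h3 i l h1.le le_rfl h2.le le_rfl⟩
  · rintro ⟨h1, h2, h3, h4⟩
    refine ⟨h1, h2, fun x y _ hx _ hy => ⟨by omega, ?_⟩⟩
    exact hy.trans (h4.trans (rowEnd_anti d a hx))

theorem IsNuTree.mem_bounds (hT : IsNuTree (rowPath d a) T) {i j : ℕ} (h : (i, j) ∈ T) :
    i ≤ a ∧ j ≤ rowEnd d a i :=
  (mem_above_rowPath d a).1 (hT.prop.1 h)

/-- No point of a `ν`-tree lies strictly northeast of another one within the Ferrers diagram. -/
theorem IsNuTree.not_northeast (hT : IsNuTree (rowPath d a) T) {i j k l : ℕ} (h : (i, j) ∈ T)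
    (h' : (k, l) ∈ T) (hk : k < i) (hj : j < l) : rowEnd d a i < l := by
  by_contra! hl
  exact hT.prop.2 _ h _ h'
    (Or.inl (isIncompatibleSW_rowPath.2 ⟨hk, hj, (hT.mem_bounds h).1, hl⟩))

/-- By maximality, a point outside a `ν`-tree is incompatible with a point of the tree. -/
theorem IsNuTree.exists_incompatible (hT : IsNuTree (rowPath d a) T) {i j : ℕ} (hi : i ≤ a)
    (hj : j ≤ rowEnd d a i) (h : (i, j) ∉ T) :
    ∃ k l, (k, l) ∈ T ∧ ((i < k ∧ l < j ∧ j ≤ rowEnd d a k) ∨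
      (k < i ∧ j < l ∧ l ≤ rowEnd d a i)) := by
  by_contra! hcon
  have hne : ∀ q ∈ T, ¬ IsIncompatible (rowPath d a) (i, j) q := by
    rintro ⟨k, l⟩ hq (hq' | hq')
    · obtain ⟨h1, h2, -, h3⟩ := isIncompatibleSW_rowPath.1 hq'
      exact absurd h3 (not_le.2 ((hcon k l hq).2 h1 h2))
    · obtain ⟨h1, h2, -, h3⟩ := isIncompatibleSW_rowPath.1 hq'
      exact absurd h3 (not_le.2 ((hcon k l hq).1 h1 h2))
  refine h (hT.le_of_ge (y := insert (i, j) T) ⟨?_, ?_⟩ (Finset.subset_insert _ _)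
    (Finset.mem_insert_self _ _))
  · exact Finset.insert_subset ((mem_above_rowPath d a).2 ⟨hi, hj⟩) hT.prop.1
  · intro p hp q hq
    rcases Finset.mem_insert.1 hp with rfl | hp <;> rcases Finset.mem_insert.1 hq with rfl | hq
    · rintro (⟨h1, -⟩ | ⟨h1, -⟩) <;> exact lt_irrefl _ h1
    · exact hne q hq
    · exact fun h' => hne p hp h'.symm
    · exact hT.prop.2 p hp q hq

/-- To the right of a point of the tree, every column is blocked from this row on.  Otherwise, a
point of the tree southwest of the missing point gives the same situation in a lower row. -/
theorem IsNuTree.mem_blocked_of_lt (hT : IsNuTree (rowPath d a) T) {k c j : ℕ} (h : (k, c) ∈ T)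
    (hc : c < j) (hj : j ≤ rowEnd d a k) : j ∈ blocked T k := by
  induction hn : a - k using Nat.strong_induction_on generalizing k c with
  | _ n ih =>
    by_cases hm : (k, j) ∈ T
    · exact mem_blocked.2 ⟨k, le_rfl, hm, c, hc, h⟩
    obtain ⟨i, l, hil, ⟨h1, h2, h3⟩ | ⟨h1, h2, h3⟩⟩ :=
      hT.exists_incompatible (hT.mem_bounds h).1 hj hm
    · have := (hT.mem_bounds hil).1
      exact blocked_anti T h1.le (ih _ (by omega) hil h2 h3 rfl)
    · exact absurd h3 (not_le.2 (hT.not_northeast h hil h1 (hc.trans h2)))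

theorem IsNuTree.notMem_blocked (hT : IsNuTree (rowPath d a) T) {k j : ℕ} (h : (k, j) ∈ T) :
    j ∉ blocked T (k + 1) := by
  intro hb
  obtain ⟨i, hi, hij, c, hc, hic⟩ := mem_blocked.1 hb
  exact absurd (hT.mem_bounds hij).2 (not_le.2 (hT.not_northeast hic h hi hc))

theorem IsNuTree.le_of_mem_blocked (hT : IsNuTree (rowPath d a) T) {k j : ℕ}
    (h : j ∈ blocked T k) : j ≤ rowEnd d a k := by
  obtain ⟨i, hi, hij, -⟩ := mem_blocked.1 h
  exact (hT.mem_bounds hij).2.trans (rowEnd_anti d a hi)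

/-- Every row of a `ν`-tree contains a point: the last column of the row that is not blocked from
below would be compatible with all points of the tree. -/
theorem IsNuTree.exists_mem_row (hT : IsNuTree (rowPath d a) T) {k : ℕ} (hk : k ≤ a) :
    ∃ j, (k, j) ∈ T := by
  by_contra! hcon
  set S := (Finset.range (rowEnd d a k + 1)).filter (· ∉ blocked T (k + 1)) with hS
  have h0 : 0 ∈ S := by
    rw [hS, Finset.mem_filter]
    exact ⟨by simp, fun h => lt_irrefl _ (pos_of_mem_blocked h)⟩
  obtain ⟨j, hjS, hmax⟩ := S.exists_max_image id ⟨0, h0⟩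
  obtain ⟨hj1, hj2⟩ := Finset.mem_filter.1 hjS
  obtain ⟨i, l, hil, ⟨h1, h2, h3⟩ | ⟨h1, h2, h3⟩⟩ :=
    hT.exists_incompatible hk (Nat.lt_succ_iff.1 (Finset.mem_range.1 hj1)) (hcon j)
  · exact hj2 (blocked_anti T h1 (hT.mem_blocked_of_lt hil h2 h3))
  · have hl : l ∈ blocked T (k + 1) := by
      by_contra hl
      exact absurd (hmax l (Finset.mem_filter.2 ⟨Finset.mem_range.2 (by omega), hl⟩))
        (not_le.2 h2)
    exact hT.notMem_blocked hil (blocked_anti T (by omega) hl)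

/-- The structure of row `k` of a `ν`-tree: its points are the columns from its first column `t` on
that are not blocked from below. -/
theorem IsNuTree.row_structure (hT : IsNuTree (rowPath d a) T) {k : ℕ} (hk : k ≤ a) :
    ∃ t ≤ rowEnd d a k, t ∉ blocked T (k + 1) ∧ (k = 0 → t = 0) ∧
      (∀ j, (k, j) ∈ T ↔ t ≤ j ∧ j ≤ rowEnd d a k ∧ j ∉ blocked T (k + 1)) ∧
      (∀ j, j ∈ blocked T k ↔ j ∈ blocked T (k + 1) ∨ (t < j ∧ j ≤ rowEnd d a k)) := by
  classical
  have hex := hT.exists_mem_row hk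
  have ht := Nat.find_spec hex
  have hmin : ∀ j, (k, j) ∈ T → Nat.find hex ≤ j := fun j hj => Nat.find_min' hex hj
  generalize Nat.find hex = t at ht hmin
  have hmem : ∀ j, (k, j) ∈ T ↔ t ≤ j ∧ j ≤ rowEnd d a k ∧ j ∉ blocked T (k + 1) := by
    refine fun j => ⟨fun h => ⟨hmin j h, (hT.mem_bounds h).2, hT.notMem_blocked h⟩, ?_⟩
    rintro ⟨h1, h2, h3⟩
    rcases h1.eq_or_lt with rfl | h1
    · exact ht
    obtain ⟨i, hi, h4⟩ := mem_blocked.1 (hT.mem_blocked_of_lt ht h1 h2)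
    rcases hi.eq_or_lt with rfl | hi
    · exact h4.1
    · exact absurd (mem_blocked.2 ⟨i, hi, h4⟩) h3
  refine ⟨t, (hT.mem_bounds ht).2, hT.notMem_blocked ht, ?_, hmem, ?_⟩
  · rintro rfl
    have h00 : (0, 0) ∈ T := by
      by_contra h
      obtain ⟨i, l, -, h | h⟩ := hT.exists_incompatible (Nat.zero_le a) (Nat.zero_le _) h <;> omega
    exact Nat.le_zero.1 (hmin 0 h00)
  · refine fun j => ⟨fun h => ?_, ?_⟩
    · obtain ⟨i, hi, h1, c, hc, h2⟩ := mem_blocked.1 h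
      rcases hi.eq_or_lt with rfl | hi
      · exact Or.inr ⟨(hmin c h2).trans_lt hc, (hT.mem_bounds h1).2⟩
      · exact Or.inl (mem_blocked.2 ⟨i, hi, h1, c, hc, h2⟩)
    · rintro (h | ⟨h1, h2⟩)
      · exact blocked_anti T (Nat.le_succ k) h
      · exact hT.mem_blocked_of_lt ht h1 h2

theorem IsNuTree.rowCard_pos (hT : IsNuTree (rowPath d a) T) {k : ℕ} (hk : k ≤ a) :
    0 < rowCard T k := by
  obtain ⟨j, hj⟩ := hT.exists_mem_row hk
  exact Finset.card_pos.2 ⟨(k, j), by simp [hj]⟩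

theorem IsNuTree.card_blocked_succ (hT : IsNuTree (rowPath d a) T) {k : ℕ} (hk : k ≤ a) :
    (blocked T k).card = (rowCard T k - 1) + (blocked T (k + 1)).card := by
  obtain ⟨t, ht, htb, -, hmem, hb⟩ := hT.row_structure hk
  have hrow : rowCard T k = ((T.filter fun p => p.1 = k).image Prod.snd).card := by
    refine (Finset.card_image_of_injOn ?_).symm
    rintro ⟨x, y⟩ hx ⟨z, w⟩ hz h
    simp only [Finset.coe_filter, Set.mem_ofPred_eq] at hx hz h
    rw [hx.2, hz.2, h]
  have hmem' : ∀ j, j ∈ (T.filter fun p => p.1 = k).image Prod.snd ↔ (k, j) ∈ T := by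
    intro j
    simp only [Finset.mem_image, Finset.mem_filter, Prod.exists, exists_eq_right]
  rw [hrow, ← Finset.card_erase_of_mem ((hmem' t).2 ((hmem t).2 ⟨le_rfl, ht, htb⟩)),
    ← Finset.card_union_of_disjoint]
  · congr 1
    ext j
    rw [hb, Finset.mem_union, Finset.mem_erase, hmem', hmem]
    by_cases hj : j ∈ blocked T (k + 1)
    · simp [hj]
    · simp only [hj, false_or, not_false_eq_true, and_true, or_false]
      omega
  · refine Finset.disjoint_left.2 fun j hj => ?_
    rw [Finset.mem_erase, hmem', hmem] at hj
    exact hj.2.2.2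

theorem IsNuTree.card_blocked (hT : IsNuTree (rowPath d a) T) (k : ℕ) :
    (blocked T k).card = rowEnd (fun i => rowCard T i - 1) a k := by
  induction hn : a + 1 - k generalizing k with
  | zero =>
    rw [rowEnd_of_lt _ (by omega), Finset.card_eq_zero, Finset.eq_empty_iff_forall_notMem]
    intro j hj
    obtain ⟨i, hi, h, -⟩ := mem_blocked.1 hj
    have := (hT.mem_bounds h).1
    omega
  | succ n ih =>
    have hk : k ≤ a := by omega
    rw [hT.card_blocked_succ hk, rowEnd_eq_add _ hk, ih (k + 1) (by omega)]

theorem IsNuTree.card_blocked_le (hT : IsNuTree (rowPath d a) T) (k : ℕ) :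
    (blocked T k).card ≤ rowEnd d a k := by
  have : blocked T k ⊆ Finset.Icc 1 (rowEnd d a k) := fun j hj =>
    Finset.mem_Icc.2 ⟨pos_of_mem_blocked hj, hT.le_of_mem_blocked hj⟩
  simpa using Finset.card_le_card this

/-- All columns but the leftmost one are blocked by some row, since column `0` of the top row belongs
to every `ν`-tree. -/
theorem IsNuTree.card_blocked_zero (hT : IsNuTree (rowPath d a) T) :
    (blocked T 0).card = rowEnd d a 0 := by
  obtain ⟨t, -, -, h0, -, hb⟩ := hT.row_structure (Nat.zero_le a)
  have : blocked T 0 = Finset.Icc 1 (rowEnd d a 0) := by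
    ext j
    refine ⟨fun hj => Finset.mem_Icc.2 ⟨pos_of_mem_blocked hj, hT.le_of_mem_blocked hj⟩, ?_⟩
    intro hj
    rw [Finset.mem_Icc] at hj
    exact (hb j).2 (Or.inr (by rw [h0 rfl]; omega))
  simp [this]

end Tree

/-! ### Left flushing -/

theorem placeRow_range (s n : ℕ) : placeRow (Finset.range s) n = List.range' s n := by
  induction n generalizing s with
  | zero => rfl
  | succ n ih =>
    have hf : Nat.find (Infinite.exists_notMem_finset (Finset.range s)) = s := by
      rw [Nat.find_eq_iff]
      simp
    rw [placeRow, hf, ← Finset.range_add_one, List.range'_succ]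
    exact congrArg _ (ih (s + 1))

/-- With the columns `0, …, s - 1` forbidden at the start, each flushed row occupies an interval, and
its first column is the last column of the flushed row below (or `s` for the bottom row). -/
theorem mem_flushRows (T : Finset (ℕ × ℕ)) {m : ℕ} (hpos : ∀ i < m, 0 < rowCard T i) (s : ℕ)
    {i j : ℕ} :
    (i, j) ∈ flushRows T (List.range m).reverse (Finset.range s) ↔
      i < m ∧ s + ∑ x ∈ Finset.Ico (i + 1) m, (rowCard T x - 1) ≤ j ∧
        j ≤ s + ∑ x ∈ Finset.Ico i m, (rowCard T x - 1) := by
  induction m generalizing s with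
  | zero => simp [flushRows]
  | succ m ih =>
    have hm := hpos m (Nat.lt_succ_self m)
    have hF : Finset.range s ∪ (List.range' s (rowCard T m)).dropLast.toFinset =
        Finset.range (s + (rowCard T m - 1)) := by
      obtain ⟨n, hn⟩ := Nat.exists_eq_succ_of_ne_zero hm.ne'
      rw [hn, Nat.succ_eq_add_one, List.range'_concat, List.dropLast_concat]
      ext x
      simp only [Finset.mem_union, Finset.mem_range, List.mem_toFinset, List.mem_range'_1]
      omega
    rw [List.range_succ, List.reverse_append, List.reverse_singleton, List.singleton_append,
      flushRows]
    change (i, j) ∈ Finset.image _ (placeRow _ (rowCard T m)).toFinset ∪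
      flushRows T _ (_ ∪ (placeRow _ (rowCard T m)).dropLast.toFinset) ↔ _
    rw [placeRow_range, hF, Finset.mem_union, ih (fun i hi => hpos i (by omega))]
    simp only [Finset.mem_image, List.mem_toFinset, List.mem_range'_1, Prod.mk.injEq]
    rcases Nat.lt_trichotomy i m with hi | rfl | hi
    · rw [Finset.sum_Ico_succ_top (show i + 1 ≤ m by omega), Finset.sum_Ico_succ_top hi.le]
      constructor
      · rintro (⟨x, -, h, -⟩ | h) <;> omega
      · exact fun h => Or.inr (by omega)
    · rw [Finset.sum_Ico_succ_top le_rfl]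
      simp only [Finset.Ico_self, Finset.sum_empty]
      constructor
      · rintro (⟨x, h, -, rfl⟩ | h) <;> omega
      · exact fun h => Or.inl ⟨j, by omega, trivial, rfl⟩
    · constructor
      · rintro (⟨x, -, h, -⟩ | h) <;> omega
      · omega

section Tree

variable {d : ℕ → ℕ} {a : ℕ} {T : Finset (ℕ × ℕ)}

theorem IsNuTree.leftFlush_eq (hT : IsNuTree (rowPath d a) T) :
    leftFlush (rowPath d a) T = LatticePath.points (rowPath (fun i => rowCard T i - 1) a) := by
  ext ⟨i, j⟩
  rw [leftFlush, count_N_rowPath, ← Finset.range_zero,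
    mem_flushRows T (fun i hi => hT.rowCard_pos (by omega)), mem_points_rowPath]
  simp [rowEnd, ← Finset.Ico_add_one_right_eq_Icc]

theorem IsNuTree.isNuPath (hT : IsNuTree (rowPath d a) T) :
    IsNuPath (rowPath d a) (rowPath (fun i => rowCard T i - 1) a) := by
  refine ⟨by simp [count_N_rowPath], ?_, ?_⟩
  · rw [count_E_rowPath, count_E_rowPath, ← hT.card_blocked, hT.card_blocked_zero]
  · rintro ⟨i, j⟩ h
    obtain ⟨h1, -, h2⟩ := (mem_points_rowPath _ a).1 h
    rw [← hT.card_blocked] at h2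
    exact (mem_above_rowPath d a).2 ⟨h1, h2.trans (hT.card_blocked_le i)⟩

end Tree

/-! ### Edelman–Greene insertion, one column at a time -/

theorem insertColumn_append {i : ℕ} {C : List ℕ} (h : ∀ x ∈ C, x ≤ i) :
    insertColumn i C = (C ++ [i], none) := by
  have : C.filter (fun a => i < a) = [] := by
    rw [List.filter_eq_nil_iff]
    intro x hx
    simpa using h x hx
  rw [insertColumn, this]
  rfl

theorem insertColumn_bump {i z : ℕ} {I R : List ℕ} (hI : ∀ x ∈ I, x < i) (hz : i < z)
    (hR : ∀ x ∈ R, z ≤ x) : insertColumn i (I ++ z :: R) = (I ++ i :: R, some z) := by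
  have hf : ((I ++ z :: R).filter (fun a => i < a)).min? = some z := by
    have h1 : I.filter (fun a => i < a) = [] := by
      rw [List.filter_eq_nil_iff]
      intro x hx
      simpa using (hI x hx).le
    rw [List.filter_append, h1, List.nil_append, List.filter_cons_of_pos (by simpa using hz),
      List.min?_eq_some_iff]
    refine ⟨List.mem_cons_self, fun x hx => ?_⟩
    rcases List.mem_cons.1 hx with rfl | hx
    · exact le_rfl
    · exact hR x (List.mem_filter.1 hx).1
  have hi : i ∉ I ++ z :: R := by
    intro h
    rcases List.mem_append.1 h with h | h
    · exact lt_irrefl _ (hI i h)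
    · rcases List.mem_cons.1 h with h | h
      · omega
      · have := hR i h
        omega
  have hzI : z ∉ I := fun h => by have := hI z h; omega
  rw [insertColumn, hf]
  simp [hi, List.replace_append, hzI]

theorem insertColumn_special {z : ℕ} {I : List ℕ} (hI : ∀ x ∈ I, x < z) :
    insertColumn z (I ++ [z, z + 1]) = (I ++ [z, z + 1], some (z + 1)) := by
  have hf : (I ++ [z, z + 1]).filter (fun a => z < a) = [z + 1] := by
    have h1 : I.filter (fun a => z < a) = [] := by
      rw [List.filter_eq_nil_iff]
      intro x hx
      simpa using (hI x hx).le
    simp [List.filter_append, h1]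
  rw [insertColumn, hf]
  simp

/-- The insertion of the letters of a word into a column, one after the other.  The result is the
new column and the word of the letters that are bumped to the next column. -/
def columnPass : List ℕ → List ℕ → List ℕ × List ℕ
  | [], C => (C, [])
  | x :: L, C =>
    ((columnPass L (insertColumn x C).1).1,
      (insertColumn x C).2.toList ++ (columnPass L (insertColumn x C).1).2)

theorem columnPass_append (L L' C : List ℕ) :
    columnPass (L ++ L') C = ((columnPass L' (columnPass L C).1).1,
      (columnPass L C).2 ++ (columnPass L' (columnPass L C).1).2) := by
  induction L generalizing C with
  | nil => rfl
  | cons x L ih => simp [columnPass, ih]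

/-- A decreasing word of letters above all entries of a column makes the column longer by its last
letter and passes on the others. -/
theorem columnPass_grow {C V : List ℕ} {y : ℕ} (hV : (V ++ [y]).Pairwise (· > ·))
    (hC : ∀ x ∈ C, x < y) : columnPass (V ++ [y]) C = (C ++ [y], V) := by
  have aux : ∀ (V L : List ℕ) (x : ℕ), (x :: L).Pairwise (· > ·) → x :: L = V ++ [y] →
      columnPass L (C ++ [x]) = (C ++ [y], V) := by
    intro V L
    induction L generalizing V with
    | nil =>
      intro x _ h
      cases V with
      | nil => simp_all [columnPass]
      | cons v V => simp at h
    | cons x' L ih =>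
      intro x hp h
      cases V with
      | nil => simp at h
      | cons v V =>
        rw [List.cons_append, List.cons.injEq] at h
        obtain ⟨rfl, h⟩ := h
        rw [List.pairwise_cons] at hp
        have hxy : ∀ w ∈ C, w < x' := by
          intro w hw
          have hy : y ∈ x' :: L := by simp [h]
          rcases List.mem_cons.1 hy with rfl | hy
          · exact hC w hw
          · exact (hC w hw).trans ((List.pairwise_cons.1 hp.2).1 y hy)
        have hb := insertColumn_bump (R := []) hxy (hp.1 x' List.mem_cons_self) (by simp)
        rw [columnPass, hb, ih V x' hp.2 h]
        rfl
  cases V with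
  | nil =>
    rw [List.nil_append, columnPass, insertColumn_append fun x hx => (hC x hx).le]
    rfl
  | cons v V =>
    rw [List.cons_append] at hV ⊢
    have hv : ∀ w ∈ C, w ≤ v := fun w hw =>
      ((hC w hw).trans ((List.pairwise_cons.1 hV).1 y (by simp))).le
    rw [columnPass, insertColumn_append hv]
    exact Prod.ext (by simp [aux (v :: V) (V ++ [y]) v hV rfl])
      (by simp [aux (v :: V) (V ++ [y]) v hV rfl])

/-- The word `lo + p - 1, …, lo + 1, lo`. -/
def downFrom (lo p : ℕ) : List ℕ := (List.range' lo p).reverse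

@[simp] theorem downFrom_zero (lo : ℕ) : downFrom lo 0 = [] := rfl

theorem downFrom_succ (lo p : ℕ) : downFrom lo (p + 1) = (lo + p) :: downFrom lo p := by
  simp [downFrom, List.range'_concat]

theorem downFrom_succ' (lo p : ℕ) : downFrom lo (p + 1) = downFrom (lo + 1) p ++ [lo] := by
  simp [downFrom, List.range'_succ]

theorem pairwise_downFrom (lo p : ℕ) : (downFrom lo p).Pairwise (· > ·) := by
  rw [downFrom, List.pairwise_reverse]
  exact List.pairwise_lt_range'

/-- An interval of letters just below the entry `z` slides this entry down to the start of the
interval, and the interval moves up by one. -/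
theorem columnPass_slide {lo p : ℕ} {I R : List ℕ} (hI : ∀ x ∈ I, x < lo)
    (hR : ∀ x ∈ R, lo + p ≤ x) :
    columnPass (downFrom lo p) (I ++ (lo + p) :: R) = (I ++ lo :: R, downFrom (lo + 1) p) := by
  induction p with
  | zero => rfl
  | succ p ih =>
    have hb := insertColumn_bump (i := lo + p) (z := lo + (p + 1)) (I := I) (R := R)
      (fun x hx => (hI x hx).trans_le (by omega)) (by omega) hR
    rw [downFrom_succ, columnPass, hb, ih (fun x hx => (Nat.le_succ _).trans (hR x hx)),
      downFrom_succ (lo + 1)]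
    simp only [Option.toList_some, List.singleton_append, Prod.mk.injEq, List.cons.injEq, and_true,
      true_and]
    omega

/-- The insertion of a decreasing word into a column `I ++ [z]`, where `y > z` is the last letter
above `z`, and the remaining letters form an interval that starts just above `I` and ends just
below `z`. -/
theorem columnPass_active {lo p y : ℕ} {I V : List ℕ} (hV : (V ++ [y]).Pairwise (· > ·))
    (hI : ∀ x ∈ I, x < lo) (hy : lo + p < y) :
    columnPass (V ++ [y] ++ downFrom lo p) (I ++ [lo + p]) =
      (I ++ [lo, y], V ++ downFrom (lo + 1) p) := by
  have hC : ∀ x ∈ I ++ [lo + p], x < y := by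
    intro x hx
    rcases List.mem_append.1 hx with hx | hx
    · have := hI x hx
      omega
    · rw [List.mem_singleton.1 hx]
      exact hy
  rw [columnPass_append, columnPass_grow hV hC]
  have := columnPass_slide (lo := lo) (p := p) (R := [y]) hI (by simpa using hy.le)
  simp [this]

/-- The variant of `columnPass_active` in which the letters `z` and `z + 1` occur: the letter `z`
then finds both `z` and `z + 1` in the column. -/
theorem columnPass_active_special {lo p : ℕ} {I V : List ℕ}
    (hV : (V ++ [lo + p + 1]).Pairwise (· > ·)) (hI : ∀ x ∈ I, x < lo) :
    columnPass (V ++ [lo + p + 1] ++ downFrom lo (p + 1)) (I ++ [lo + p]) =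
      (I ++ [lo, lo + p + 1], V ++ downFrom (lo + 1) (p + 1)) := by
  have hC : ∀ x ∈ I ++ [lo + p], x < lo + p + 1 := by
    intro x hx
    rcases List.mem_append.1 hx with hx | hx
    · have := hI x hx
      omega
    · rw [List.mem_singleton.1 hx]
      omega
  have hs := insertColumn_special (z := lo + p) (I := I) (fun x hx => (hI x hx).trans_le (by omega))
  have := columnPass_slide (lo := lo) (p := p) (R := [lo + p + 1]) hI (by simp)
  rw [columnPass_append, columnPass_grow hV hC, downFrom_succ, columnPass, List.append_assoc,
    List.singleton_append, hs, this, downFrom_succ (lo + 1)]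
  simp [add_right_comm]

/-! ### Insertion of a word into a tableau -/

/-- The successive insertion of the letters of a word into a tableau. -/
def insertWord (L : List ℕ) (X : List (List ℕ)) : List (List ℕ) :=
  L.foldl (fun X i => (insertTableau i X).1) X

theorem insertWord_cons_tableau (L : List ℕ) (C : List ℕ) (X : List (List ℕ)) :
    insertWord L (C :: X) = (columnPass L C).1 :: insertWord (columnPass L C).2 X := by
  induction L generalizing C X with
  | nil => rfl
  | cons i L ih =>
    have hs : ∀ D, insertWord (i :: L) D = insertWord L (insertTableau i D).1 := fun _ => rfl
    rw [hs, insertTableau, columnPass]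
    rcases hins : insertColumn i C with ⟨C', _ | j⟩
    · simp [ih]
    · exact ih C' _

theorem insertWord_nil_tableau {L : List ℕ} (hL : L ≠ []) :
    insertWord L [] = insertWord L [[]] := by
  cases L with
  | nil => exact absurd rfl hL
  | cons i L => rfl

/-- The word that is inserted into the column with index `c` when the word `L` is inserted into
the tableau with columns `φ 0, φ 1, …`. -/
def passInput (φ : ℕ → List ℕ) (L : List ℕ) : ℕ → List ℕ
  | 0 => L
  | c + 1 => (columnPass (passInput φ L c) (φ c)).2

theorem passInput_succ_left (φ : ℕ → List ℕ) (L : List ℕ) (c : ℕ) :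
    passInput φ L (c + 1) = passInput (fun e => φ (e + 1)) (columnPass L (φ 0)).2 c := by
  induction c with
  | zero => rfl
  | succ c ih => rw [passInput, ih, passInput]

theorem getD_insertWord (L : List ℕ) (X : List (List ℕ)) (c : ℕ) :
    (insertWord L X).getD c [] =
      (columnPass (passInput (fun e => X.getD e []) L c) (X.getD c [])).1 := by
  induction c generalizing L X with
  | zero =>
    rcases X with _ | ⟨C, X⟩
    · rcases L with _ | ⟨i, L⟩
      · rfl
      · rw [insertWord_nil_tableau (by simp), insertWord_cons_tableau]
        rfl
    · rw [insertWord_cons_tableau]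
      rfl
  | succ c ih =>
    rw [passInput_succ_left]
    rcases X with _ | ⟨C, X⟩
    · rcases L with _ | ⟨i, L⟩
      · have := ih [] []
        simpa [insertWord, columnPass] using this
      · rw [insertWord_nil_tableau (by simp), insertWord_cons_tableau, List.getD_cons_succ, ih]
        rfl
    · rw [insertWord_cons_tableau, List.getD_cons_succ, ih]
      rfl

/-! ### Insertion of one row of the reading word -/

/-- The letters that a row contributes to the reading word, when `p` tells which columns `j ≤ b` of
row `k` are missing in the tree, restricted to the columns `j ≥ s`. -/
def rowLetters (p : ℕ → Bool) (k b s : ℕ) : List ℕ :=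
  ((List.range' s (b + 1 - s)).reverse.filter p).map fun j => k + j + 1

theorem rowLetters_step {p : ℕ → Bool} {k b s : ℕ} (hs : s ≤ b) :
    rowLetters p k b s = rowLetters p k b (s + 1) ++ if p s then [k + s + 1] else [] := by
  have : b + 1 - s = (b + 1 - (s + 1)) + 1 := by omega
  rw [rowLetters, rowLetters, this, List.range'_succ, List.reverse_cons, List.filter_append,
    List.map_append]
  cases hp : p s <;> simp [hp]

theorem rowLetters_eq_nil {p : ℕ → Bool} {k b s : ℕ} (h : ∀ j, s ≤ j → p j = false) :
    rowLetters p k b s = [] := by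
  rw [rowLetters, List.map_eq_nil_iff, List.filter_eq_nil_iff]
  intro j hj
  rw [List.mem_reverse, List.mem_range'_1] at hj
  simp [h j hj.1]

theorem pairwise_rowLetters (p : ℕ → Bool) (k b s : ℕ) :
    (rowLetters p k b s).Pairwise (· > ·) := by
  rw [rowLetters, List.pairwise_map]
  refine List.Pairwise.filter _ ?_
  rw [List.pairwise_reverse]
  exact List.Pairwise.imp (fun h => by omega) (List.pairwise_lt_range' (s := s) (n := b + 1 - s))

/-- The shape of the columns `φ c` of the insertion tableau after the rows before row `k`, where `G`
is the set of blocked columns.  The `c`-th element `g` of `G` determines the last entry `g + k` of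
the column with index `c`, which has the maximal possible length `k`.  The columns with index at
least the size of `G` are shorter. -/
structure ColumnState (k : ℕ) (G : Finset ℕ) (φ : ℕ → List ℕ) : Prop where
  active : ∀ g ∈ G, (k = 0 ∧ φ (Nat.count (· ∈ G) g) = []) ∨
    ∃ I, φ (Nat.count (· ∈ G) g) = I ++ [g + k] ∧ I.length + 1 = k ∧
      ∀ x ∈ I, x ≤ Nat.count (· ∈ G) g + k
  inactive : ∀ c, G.card ≤ c → (φ c).length ≤ k - 1 ∧ ∀ x ∈ φ c, x ≤ c + k

theorem count_mem_eq_card {H : Finset ℕ} {n : ℕ} (h : ∀ j ∈ H, j < n) :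
    Nat.count (· ∈ H) n = H.card := by
  rw [Nat.count_eq_card_filter_range]
  congr 1
  ext j
  simpa using h j

/-- In a row whose first point of the tree is in column `t`, the number of columns `j < s` that are
missing in the tree, but not blocked from below by `H`. -/
def freeCount (H : Finset ℕ) (t s : ℕ) : ℕ := Nat.count (fun j => j < t ∧ j ∉ H) s

theorem freeCount_succ (H : Finset ℕ) (t s : ℕ) :
    freeCount H t (s + 1) = freeCount H t s + if s < t ∧ s ∉ H then 1 else 0 :=
  Nat.count_succ _ _

theorem count_add_freeCount {H : Finset ℕ} {t s : ℕ} (h : s ≤ t) :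
    Nat.count (· ∈ H) s + freeCount H t s = s := by
  induction s with
  | zero => simp [freeCount]
  | succ s ih =>
    have := ih (by omega)
    rw [Nat.count_succ, freeCount_succ]
    by_cases hs : s ∈ H
    · simp only [hs, if_true, not_true_eq_false, and_false, if_false]
      omega
    · simp only [hs, if_false, not_false_eq_true, and_true, show s < t by omega, if_true]
      omega

theorem freeCount_of_ge {H : Finset ℕ} {t s : ℕ} (h : t ≤ s) :
    freeCount H t s = freeCount H t t := by
  induction s, h using Nat.le_induction with
  | base => rfl
  | succ s h ih => rw [freeCount_succ, ih, if_neg (by omega), add_zero]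

section RowStep

variable {k r t b : ℕ} {H G : Finset ℕ} {p : ℕ → Bool} {φ : ℕ → List ℕ}

theorem count_blocked_of_le (hG : ∀ j, j ∈ G ↔ j ∈ H ∨ (t < j ∧ j ≤ r)) {s : ℕ} (hs : s ≤ t) :
    Nat.count (· ∈ G) s = Nat.count (· ∈ H) s := by
  rw [Nat.count_eq_card_filter_range, Nat.count_eq_card_filter_range]
  congr 1
  refine Finset.filter_congr fun j hj => ?_
  rw [Finset.mem_range] at hj
  rw [hG]
  exact or_iff_left (by omega)

theorem count_blocked_of_gt (htH : t ∉ H) (hG : ∀ j, j ∈ G ↔ j ∈ H ∨ (t < j ∧ j ≤ r)) {s : ℕ}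
    (hts : t < s) (hs : s ≤ r + 1) : Nat.count (· ∈ G) s + freeCount H t t + 1 = s := by
  induction s, hts using Nat.le_induction with
  | base =>
    have h := count_add_freeCount (H := H) (le_refl t)
    have htG : t ∉ G := fun h => ((hG t).1 h).elim htH fun h => lt_irrefl _ h.1
    rw [Nat.count_succ, if_neg htG, count_blocked_of_le hG le_rfl]
    omega
  | succ s hts ih =>
    have := ih (by omega)
    rw [Nat.count_succ, if_pos ((hG s).2 (Or.inr ⟨hts, by omega⟩))]
    omega

theorem card_blocked_add (htr : t ≤ r) (htH : t ∉ H) (hHr : ∀ j ∈ H, j ≤ r)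
    (hG : ∀ j, j ∈ G ↔ j ∈ H ∨ (t < j ∧ j ≤ r)) : G.card + freeCount H t t = r := by
  have hGr : ∀ j ∈ G, j < r + 1 := fun j hj => by
    rcases (hG j).1 hj with h | h
    · exact Nat.lt_succ_iff.2 (hHr j h)
    · omega
  have := count_blocked_of_gt htH hG (s := r + 1) (by omega) le_rfl
  rw [count_mem_eq_card hGr] at this
  omega

/-- In an active column whose index is at least the number of the columns `j < t` blocked from
below, the last entry is just above the interval formed by the letters of all free columns of
row `k`. -/
theorem ColumnState.column_of_gt (hφ : ColumnState k G φ) (htH : t ∉ H)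
    (hG : ∀ j, j ∈ G ↔ j ∈ H ∨ (t < j ∧ j ≤ r)) {c : ℕ} (hc : Nat.count (· ∈ H) t ≤ c)
    (hcr : c + freeCount H t t < r) :
    (k = 0 ∧ φ c = []) ∨ ∃ I, φ c = I ++ [k + 1 + c + freeCount H t t] ∧ I.length + 1 = k ∧
      ∀ x ∈ I, x < k + 1 + c := by
  have ht := count_add_freeCount (H := H) (le_refl t)
  have hg : Nat.count (· ∈ G) (c + freeCount H t t + 1) = c := by
    have := count_blocked_of_gt htH hG (s := c + freeCount H t t + 1) (by omega) (by omega)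
    omega
  have := hφ.active (c + freeCount H t t + 1) ((hG _).2 (Or.inr (by omega)))
  rw [hg] at this
  refine this.imp id ?_
  rintro ⟨I, h1, h2, h3⟩
  refine ⟨I, ?_, h2, fun x hx => ?_⟩
  · rw [h1, show c + freeCount H t t + 1 + k = k + 1 + c + freeCount H t t by omega]
  · have := h3 x hx
    omega

/-- The insertion of the remaining letters of a row into the column that belongs to a column `s`
blocked from below. -/
theorem ColumnState.columnPass_blocked (hφ : ColumnState k G φ) (hk : k = 0 → t = 0)
    (hrb : r ≤ b) (h0 : 0 ∉ G) (htH : t ∉ H)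
    (hHr : ∀ j ∈ H, j ≤ r) (hG : ∀ j, j ∈ G ↔ j ∈ H ∨ (t < j ∧ j ≤ r))
    (hp : ∀ j, p j = true ↔ j ≤ r ∧ (j ∈ H ∨ j < t)) {s : ℕ} (hs : s ∈ H) :
    ∃ I, columnPass (rowLetters p k b s ++
        downFrom (k + 1 + Nat.count (· ∈ H) s) (freeCount H t s)) (φ (Nat.count (· ∈ H) s)) =
      (I ++ [s + (k + 1)], rowLetters p k b (s + 1) ++
        downFrom (k + 1 + Nat.count (· ∈ H) s + 1) (freeCount H t s)) ∧
      I.length = k ∧ ∀ x ∈ I, x ≤ Nat.count (· ∈ H) s + (k + 1) := by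
  have hsr := hHr s hs
  have hst : s ≠ t := fun h => htH (h ▸ hs)
  have hV := pairwise_rowLetters p k b s
  have hL := rowLetters_step (p := p) (k := k) (hsr.trans hrb)
  rw [if_pos ((hp s).2 ⟨hsr, Or.inl hs⟩)] at hL
  rw [hL] at hV ⊢
  -- For `s < t`, the entry `s + k` of the column is the letter of the last free column before `s`.
  rcases Nat.lt_or_ge s t with hlt | hge
  · have hs0 : 0 < s := Nat.pos_of_ne_zero fun h => h0 ((hG 0).2 (Or.inl (h ▸ hs)))
    have hH0 : 0 ∉ H := fun h => h0 ((hG 0).2 (Or.inl h))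
    have hc := count_add_freeCount (H := H) hlt.le
    have hf : 1 ≤ freeCount H t s := by
      have h1 : freeCount H t 1 = 1 := by
        have h := freeCount_succ H t 0
        rw [if_pos ⟨by omega, hH0⟩] at h
        simpa [freeCount] using h
      rw [← h1]
      exact Nat.count_monotone _ hs0
    have hcol := hφ.active s ((hG s).2 (Or.inl hs))
    rw [count_blocked_of_le hG hlt.le] at hcol
    obtain ⟨hk0, -⟩ | ⟨I, hI, hlen, hIle⟩ := hcol
    · have := hk hk0
      omega
    · generalize Nat.count (· ∈ H) s = c at *
      obtain ⟨f, hf'⟩ := Nat.exists_eq_add_of_le' hf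
      rw [hf'] at hc ⊢
      have e1 : k + s + 1 = k + 1 + c + f + 1 := by omega
      have e2 : s + k = k + 1 + c + f := by omega
      have e3 : s + (k + 1) = k + 1 + c + f + 1 := by omega
      rw [e1] at hV ⊢
      rw [hI, e2, e3, columnPass_active_special hV fun x hx => by have := hIle x hx; omega]
      refine ⟨I ++ [k + 1 + c], by simp, by simpa using hlen, fun x hx => ?_⟩
      rcases List.mem_append.1 hx with hx | hx
      · exact (hIle x hx).trans (by omega)
      · rw [List.mem_singleton.1 hx]
        omega
  · have hmono : Nat.count (· ∈ H) t ≤ Nat.count (· ∈ H) s := Nat.count_monotone _ hge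
    have hlt : Nat.count (· ∈ H) s + freeCount H t t < s := by
      have h1 := count_blocked_of_gt htH hG (s := s) (by omega) (by omega)
      have h2 : Nat.count (· ∈ H) s ≤ Nat.count (· ∈ G) s :=
        Nat.count_mono_left fun j _ hj => (hG j).2 (Or.inl hj)
      omega
    have hcol := hφ.column_of_gt htH hG hmono (by omega)
    rw [freeCount_of_ge hge]
    have e3 : s + (k + 1) = k + s + 1 := by omega
    rw [e3]
    obtain ⟨hk0, hnil⟩ | ⟨I, hI, hlen, hIlt⟩ := hcol
    · have hf0 : freeCount H t t = 0 := by
        rw [hk hk0]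
        rfl
      rw [hf0, downFrom_zero, downFrom_zero, List.append_nil, List.append_nil, hnil,
        columnPass_grow hV (by simp)]
      exact ⟨[], rfl, hk0.symm, by simp⟩
    · rw [hI, columnPass_active hV hIlt (by omega)]
      refine ⟨I ++ [k + 1 + Nat.count (· ∈ H) s], by simp, by simpa using hlen, fun x hx => ?_⟩
      rcases List.mem_append.1 hx with hx | hx
      · exact (hIlt x hx).le.trans (by omega)
      · rw [List.mem_singleton.1 hx]
        omega

/-- The letters that reach the column with index `#{j ∈ H | j < s}`: those from the columns `j ≥ s`
are unchanged, and those from free columns `j < s` have been compressed to an interval. -/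
theorem ColumnState.passInput_count (hφ : ColumnState k G φ) (hk : k = 0 → t = 0)
    (hrb : r ≤ b) (h0 : 0 ∉ G) (htH : t ∉ H)
    (hHr : ∀ j ∈ H, j ≤ r) (hG : ∀ j, j ∈ G ↔ j ∈ H ∨ (t < j ∧ j ≤ r))
    (hp : ∀ j, p j = true ↔ j ≤ r ∧ (j ∈ H ∨ j < t)) {s : ℕ} (hs : s ≤ r + 1) :
    passInput φ (rowLetters p k b 0) (Nat.count (· ∈ H) s) = rowLetters p k b s ++
      downFrom (k + 1 + Nat.count (· ∈ H) s) (freeCount H t s) := by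
  induction s with
  | zero => simp [passInput, freeCount]
  | succ s ih =>
    have ih := ih (by omega)
    rw [Nat.count_succ, freeCount_succ]
    by_cases hsH : s ∈ H
    · obtain ⟨I, hI, -, -⟩ := hφ.columnPass_blocked hk hrb h0 htH hHr hG hp hsH
      rw [if_pos hsH, if_neg (by simp [hsH]), passInput, ih, hI]
      simp [add_assoc]
    · rw [if_neg hsH, Nat.add_zero, ih, rowLetters_step (p := p) (k := k) (show s ≤ b by omega)]
      by_cases hst : s < t
      · have hc := count_add_freeCount (H := H) hst.le
        rw [if_pos ((hp s).2 ⟨by omega, Or.inr hst⟩), if_pos ⟨hst, hsH⟩, downFrom_succ,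
          List.append_assoc, List.singleton_append,
          show k + s + 1 = k + 1 + Nat.count (· ∈ H) s + freeCount H t s by omega]
      · have hps : ¬ p s = true := fun h => ((hp s).1 h).2.elim hsH hst
        rw [if_neg hps, if_neg (fun h => hst h.1), List.append_nil]
        rfl

/-- The effect of one row of the reading word on the columns of the insertion tableau. -/
theorem ColumnState.row_step (hφ : ColumnState k G φ) (hk : k = 0 → t = 0) (htr : t ≤ r)
    (hrb : r ≤ b) (h0 : 0 ∉ G) (htH : t ∉ H)
    (hHr : ∀ j ∈ H, j ≤ r) (hG : ∀ j, j ∈ G ↔ j ∈ H ∨ (t < j ∧ j ≤ r))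
    (hp : ∀ j, p j = true ↔ j ≤ r ∧ (j ∈ H ∨ j < t)) :
    ColumnState (k + 1) H
      fun c => (columnPass (passInput φ (rowLetters p k b 0) c) (φ c)).1 := by
  have hcardH : Nat.count (· ∈ H) (r + 1) = H.card :=
    count_mem_eq_card fun j hj => Nat.lt_succ_iff.2 (hHr j hj)
  have hcardG := card_blocked_add htr htH hHr hG
  have htH' : Nat.count (· ∈ H) t ≤ H.card := hcardH ▸ Nat.count_monotone _ (by omega)
  have hk0 : k = 0 → freeCount H t t = 0 := fun h => by
    rw [hk h]
    rfl
  -- Tableau columns with index between the sizes of `H` and `G` receive the compressed free letters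
  -- only, and do not grow.
  have hmid : ∀ c, H.card ≤ c → c < G.card →
      (columnPass (downFrom (k + 1 + c) (freeCount H t t)) (φ c)).2 =
        downFrom (k + 1 + (c + 1)) (freeCount H t t) ∧
      (columnPass (downFrom (k + 1 + c) (freeCount H t t)) (φ c)).1.length ≤ k ∧
      ∀ x ∈ (columnPass (downFrom (k + 1 + c) (freeCount H t t)) (φ c)).1, x ≤ c + (k + 1) := by
    intro c hc hcG
    obtain ⟨h1, h2⟩ | ⟨I, hI, hlen, hIlt⟩ :=
      hφ.column_of_gt htH hG (htH'.trans hc) (by omega)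
    · rw [hk0 h1, h2]
      simp [columnPass]
    · rw [hI, columnPass_slide (R := []) hIlt (by simp)]
      refine ⟨by simp [add_assoc], by simp [hlen], fun x hx => ?_⟩
      rcases List.mem_append.1 hx with hx | hx
      · exact (hIlt x hx).le.trans (by omega)
      · rw [List.mem_singleton.1 hx]
        omega
  have hin : ∀ c, H.card ≤ c → c ≤ G.card →
      passInput φ (rowLetters p k b 0) c = downFrom (k + 1 + c) (freeCount H t t) := by
    intro c hc
    induction c, hc using Nat.le_induction with
    | base =>
      intro _
      have h := hφ.passInput_count hk hrb h0 htH hHr hG hp (le_refl (r + 1))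
      have hnil : rowLetters p k b (r + 1) = [] := rowLetters_eq_nil fun j hj => by
        rw [← Bool.not_eq_true, hp]
        omega
      rwa [hcardH, freeCount_of_ge (by omega), hnil, List.nil_append] at h
    | succ c hc ih =>
      intro hcG
      rw [passInput, ih (by omega), (hmid c hc (by omega)).1]
  -- Each column that was inactive before keeps the smallest letter of the interval that reaches it
  -- and passes on the rest.
  have hout : ∀ c, G.card ≤ c → ∃ f, (k = 0 → f = 0) ∧
      passInput φ (rowLetters p k b 0) c = downFrom (k + 1 + c) f := by
    have hHG : H.card ≤ G.card := Finset.card_le_card fun j hj => (hG j).2 (Or.inl hj)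
    intro c hc
    induction c, hc using Nat.le_induction with
    | base => exact ⟨_, hk0, hin _ hHG le_rfl⟩
    | succ c hc ih =>
      obtain ⟨f, hf, h⟩ := ih
      rw [passInput, h]
      cases f with
      | zero => exact ⟨0, fun _ => rfl, by simp [columnPass]⟩
      | succ f =>
        refine ⟨f, fun h => by have := hf h; omega, ?_⟩
        have hV := pairwise_downFrom (k + 1 + c) (f + 1)
        rw [downFrom_succ'] at hV ⊢
        rw [columnPass_grow hV fun x hx => by have := (hφ.inactive c hc).2 x hx; omega]
        rfl
  refine ⟨fun s hs => Or.inr ?_, fun c hc => ?_⟩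
  · obtain ⟨I, hI, h1, h2⟩ := hφ.columnPass_blocked hk hrb h0 htH hHr hG hp hs
    refine ⟨I, ?_, by omega, h2⟩
    rw [hφ.passInput_count hk hrb h0 htH hHr hG hp (by have := hHr s hs; omega), hI]
  · rcases Nat.lt_or_ge c G.card with hcG | hcG
    · rw [hin c hc hcG.le]
      exact (hmid c hc hcG).2
    · obtain ⟨f, hf, h⟩ := hout c hcG
      have hst := hφ.inactive c hcG
      rw [h]
      cases f with
      | zero =>
        refine ⟨hst.1.trans (by omega), fun x hx => (hst.2 x hx).trans (by omega)⟩
      | succ f =>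
        have hkpos : k ≠ 0 := fun h => by have := hf h; omega
        have hV := pairwise_downFrom (k + 1 + c) (f + 1)
        rw [downFrom_succ'] at hV ⊢
        rw [columnPass_grow hV fun x hx => by have := hst.2 x hx; omega]
        refine ⟨by have := hst.1; simp; omega, fun x hx => ?_⟩
        rcases List.mem_append.1 hx with hx | hx
        · exact (hst.2 x hx).trans (by omega)
        · rw [List.mem_singleton.1 hx]
          omega

end RowStep

theorem ColumnState.length_of_lt {k : ℕ} {G : Finset ℕ} {φ : ℕ → List ℕ} (hφ : ColumnState k G φ)
    {c : ℕ} (hc : c < G.card) : (φ c).length = k := by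
  have hc' : ∀ hf : (Set.ofPred (· ∈ G)).Finite, c < hf.toFinset.card := fun hf => by
    convert hc
    ext
    simp
  have h := hφ.active _ (Nat.nth_mem c hc')
  rw [Nat.count_nth hc'] at h
  obtain ⟨h1, h2⟩ | ⟨I, hI, h1, -⟩ := h
  · rw [h2, h1]; rfl
  · rw [hI, ← h1]; simp

/-! ### The recording tableau -/

/-- One step of the column Edelman–Greene correspondence. -/
def recordStep (XY : List (List ℕ) × (ℕ → List ℕ)) (ab : ℕ × ℕ) :
    List (List ℕ) × (ℕ → List ℕ) :=
  ((insertTableau ab.2 XY.1).1,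
    Function.update XY.2 (insertTableau ab.2 XY.1).2
      (XY.2 (insertTableau ab.2 XY.1).2 ++ [ab.1]))

theorem edelmanGreene_eq (w : List (ℕ × ℕ)) :
    edelmanGreene w = w.foldl recordStep ([], fun _ => []) := rfl

theorem length_insertColumn (i : ℕ) (C : List ℕ) :
    (insertColumn i C).1.length = C.length + if (insertColumn i C).2 = none then 1 else 0 := by
  rw [insertColumn]
  split
  · simp
  · split <;> simp

theorem length_insertTableau (i : ℕ) (X : List (List ℕ)) (c : ℕ) :
    ((insertTableau i X).1.getD c []).length =
      (X.getD c []).length + if c = (insertTableau i X).2 then 1 else 0 := by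
  induction X generalizing i c with
  | nil => cases c <;> simp [insertTableau]
  | cons C X ih =>
    have hlen := length_insertColumn i C
    rw [insertTableau]
    rcases hins : insertColumn i C with ⟨C', _ | j⟩ <;> rw [hins] at hlen
    · cases c with
      | zero => simpa using hlen
      | succ c => simp
    · cases c with
      | zero => simpa using hlen
      | succ c => simpa using ih j c

/-- Letters with the same label `lab` extend the columns of the recording tableau by copies of
`lab`. -/
theorem foldl_recordStep (lab : ℕ) (L : List ℕ) (X : List (List ℕ)) (Y : ℕ → List ℕ) :
    ((L.map fun x => (lab, x)).foldl recordStep (X, Y)).1 = insertWord L X ∧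
      ∀ c, ∃ e, ((L.map fun x => (lab, x)).foldl recordStep (X, Y)).2 c =
          Y c ++ List.replicate e lab ∧
        ((insertWord L X).getD c []).length = (X.getD c []).length + e := by
  induction L generalizing X Y with
  | nil => exact ⟨rfl, fun c => ⟨0, by simp, rfl⟩⟩
  | cons x L ih =>
    rw [List.map_cons, List.foldl_cons]
    obtain ⟨h1, h2⟩ := ih (recordStep (X, Y) (lab, x)).1 (recordStep (X, Y) (lab, x)).2
    refine ⟨h1, fun c => ?_⟩
    obtain ⟨e, h3, h4⟩ := h2 c
    have hlen := length_insertTableau x X c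
    change (List.getD (recordStep (X, Y) (lab, x)).1 c []).length = _ at hlen
    refine ⟨(if c = (insertTableau x X).2 then 1 else 0) + e, ?_, ?_⟩
    · rw [show ((recordStep (X, Y) (lab, x)).1, (recordStep (X, Y) (lab, x)).2) =
        recordStep (X, Y) (lab, x) from rfl] at h3
      rw [h3]
      by_cases hc : c = (insertTableau x X).2
      · rw [if_pos hc, List.replicate_add]
        simp [recordStep, hc]
      · rw [if_neg hc, Nat.zero_add]
        simp [recordStep, Function.update_of_ne hc]
    · change ((insertWord L (recordStep (X, Y) (lab, x)).1).getD c []).length = _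
      rw [h4, hlen]
      omega

/-- The part of the reading biword that stems from row `i`. -/
def readingRow (ν : LatticePath) (T : Finset (ℕ × ℕ)) (i : ℕ) : List (ℕ × ℕ) :=
  (rowLetters (fun j => (i, j) ∈ ν.above \ T) i (ν.count Step.E) 0).map fun x => (i + 1, x)

theorem readingBiword_eq (ν : LatticePath) (T : Finset (ℕ × ℕ)) :
    readingBiword ν T = (List.range (ν.count Step.N + 1)).flatMap (readingRow ν T) := by
  rw [readingBiword]
  congr 1
  funext i
  simp [readingRow, rowLetters, List.range_eq_range', Function.comp_def]

/-- The pair of tableaux after the rows `0, …, K - 1` of the reading biword. -/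
def prefixTableaux (ν : LatticePath) (T : Finset (ℕ × ℕ)) (K : ℕ) :
    List (List ℕ) × (ℕ → List ℕ) :=
  edelmanGreene ((List.range K).flatMap (readingRow ν T))

theorem prefixTableaux_succ (ν : LatticePath) (T : Finset (ℕ × ℕ)) (K : ℕ) :
    (prefixTableaux ν T (K + 1)).1 = insertWord
        (rowLetters (fun j => (K, j) ∈ ν.above \ T) K (ν.count Step.E) 0)
        (prefixTableaux ν T K).1 ∧
      ∀ c, ∃ e, (prefixTableaux ν T (K + 1)).2 c =
          (prefixTableaux ν T K).2 c ++ List.replicate e (K + 1) ∧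
        ((prefixTableaux ν T (K + 1)).1.getD c []).length =
          ((prefixTableaux ν T K).1.getD c []).length + e := by
  have h : prefixTableaux ν T (K + 1) =
      (readingRow ν T K).foldl recordStep (prefixTableaux ν T K) := by
    rw [prefixTableaux, prefixTableaux, edelmanGreene_eq, edelmanGreene_eq, List.range_succ,
      List.flatMap_append, List.foldl_append]
    simp
  obtain ⟨h1, h2⟩ := foldl_recordStep (K + 1)
    (rowLetters (fun j => (K, j) ∈ ν.above \ T) K (ν.count Step.E) 0)
    (prefixTableaux ν T K).1 (prefixTableaux ν T K).2
  rw [← h1] at h2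
  rw [h]
  exact ⟨h1, h2⟩

section Tree

variable {d : ℕ → ℕ} {a : ℕ} {T : Finset (ℕ × ℕ)}

theorem IsNuTree.columnState (hT : IsNuTree (rowPath d a) T) {K : ℕ} (hK : K ≤ a + 1) :
    ColumnState K (blocked T K) fun c => (prefixTableaux (rowPath d a) T K).1.getD c [] := by
  induction K with
  | zero =>
    exact ⟨fun g _ => Or.inl ⟨rfl, rfl⟩, fun c _ => ⟨Nat.le_refl 0, fun x hx => by
      simp [prefixTableaux, edelmanGreene] at hx⟩⟩
  | succ K ih =>
    have hKa : K ≤ a := by omega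
    obtain ⟨t, ht, htb, ht0, hmem, hb⟩ := hT.row_structure hKa
    have hle : ∀ j ∈ blocked T (K + 1), j ≤ rowEnd d a K := fun j hj =>
      hT.le_of_mem_blocked (blocked_anti T (Nat.le_succ K) hj)
    have hp : ∀ j, (decide ((K, j) ∈ LatticePath.above (rowPath d a) \ T)) = true ↔
        j ≤ rowEnd d a K ∧ (j ∈ blocked T (K + 1) ∨ j < t) := by
      intro j
      rw [decide_eq_true_iff, Finset.mem_sdiff, mem_above_rowPath, hmem]
      constructor
      · rintro ⟨⟨-, h1⟩, h2⟩
        refine ⟨h1, ?_⟩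
        by_contra! h3
        exact h2 ⟨h3.2, h1, h3.1⟩
      · rintro ⟨h1, h2⟩
        refine ⟨⟨hKa, h1⟩, fun h3 => h2.elim h3.2.2 fun h => ?_⟩
        omega
    have hstep := (ih (by omega)).row_step ht0 ht (rowEnd_anti d a (Nat.zero_le K))
      (fun h => lt_irrefl _ (pos_of_mem_blocked h)) htb hle hb hp
    rw [(prefixTableaux_succ _ T K).1, count_E_rowPath]
    simpa only [getD_insertWord] using hstep

/-- After `K` rows, a box of the recording tableau in row `k < K` is labelled by its row number
exactly when its column had the maximal length after row `k`. -/
theorem IsNuTree.prefix_label_iff (hT : IsNuTree (rowPath d a) T) {K : ℕ} (hK : K ≤ a + 1) :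
    (∀ c, ((prefixTableaux (rowPath d a) T K).2 c).length =
      ((prefixTableaux (rowPath d a) T K).1.getD c []).length) ∧
    ∀ k c, ((prefixTableaux (rowPath d a) T K).2 c)[k]? = some (k + 1) ↔
      k < K ∧ c < (blocked T (k + 1)).card := by
  induction K with
  | zero => simp [prefixTableaux, edelmanGreene]
  | succ K ih =>
    obtain ⟨ih1, ih2⟩ := ih (by omega)
    have hstate := hT.columnState (K := K) (by omega)
    have hstate' := hT.columnState hK
    have h2 := (prefixTableaux_succ (rowPath d a) T K).2
    refine ⟨fun c => ?_, fun k c => ?_⟩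
    · obtain ⟨e, h3, h4⟩ := h2 c
      rw [h3, h4, List.length_append, ih1, List.length_replicate]
    · obtain ⟨e, h3, h4⟩ := h2 c
      have hlenK : ((prefixTableaux (rowPath d a) T K).1.getD c []).length ≤ K := by
        rcases Nat.lt_or_ge c (blocked T K).card with hc | hc
        · exact (hstate.length_of_lt hc).le
        · exact (hstate.inactive c hc).1.trans (Nat.sub_le _ _)
      have hmax : K < ((prefixTableaux (rowPath d a) T K).2 c).length + e ↔
          c < (blocked T (K + 1)).card := by
        rw [ih1, ← h4]
        constructor
        · intro h
          by_contra! hc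
          have := (hstate'.inactive c hc).1
          omega
        · intro hc
          have := hstate'.length_of_lt hc
          omega
      rw [← ih1] at hlenK
      rw [h3]
      rcases Nat.lt_or_ge k ((prefixTableaux (rowPath d a) T K).2 c).length with hk | hk
      · rw [List.getElem?_append_left hk, ih2]
        exact and_congr_left fun _ => by omega
      · have hnone := (ih2 k c).not.1 (by rw [List.getElem?_eq_none hk]; simp)
        rw [List.getElem?_append_right hk, List.getElem?_replicate]
        constructor
        · intro h
          split at h
          · obtain rfl : K = k := by simpa using h
            exact ⟨Nat.lt_succ_self K, hmax.1 (by omega)⟩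
          · simp at h
        · rintro ⟨hkK, hc⟩
          obtain rfl : k = K := by
            by_contra hne
            exact hnone ⟨by omega, hc⟩
          rw [if_pos (by have := hmax.2 hc; omega)]

theorem IsNuTree.recordingLabel_iff (hT : IsNuTree (rowPath d a) T) (k c : ℕ) :
    recordingLabel (rowPath d a) T k c = some (k + 1) ↔
      (rowPath (fun i => rowCard T i - 1) a).IsBoxAbove k c := by
  have h := (hT.prefix_label_iff le_rfl).2 k c
  rw [recordingLabel, readingBiword_eq, count_N_rowPath, LatticePath.IsBoxAbove,
    mem_above_rowPath, ← hT.card_blocked]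
  refine h.trans ⟨fun ⟨_, h2⟩ => ⟨?_, h2⟩, fun ⟨h1, h2⟩ => ⟨by omega, h2⟩⟩
  by_contra! hk
  rw [hT.card_blocked, rowEnd_of_lt _ hk] at h2
  exact absurd h2 (Nat.not_lt_zero c)

end Tree

end NuTree

theorem proposition5p9 (ν : NuTree.LatticePath) (T : Finset (ℕ × ℕ)) (hT : NuTree.IsNuTree ν T) :
    ∃ μ : NuTree.LatticePath,
      (∀ μ' : NuTree.LatticePath, NuTree.IsEdelmanGreenePath ν T μ' ↔ μ' = μ) ∧
      (∀ μ' : NuTree.LatticePath, NuTree.IsLeftFlushingPath ν T μ' ↔ μ' = μ) := by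
  obtain ⟨d, hd⟩ := NuTree.exists_rowPath ν
  generalize ν.count NuTree.Step.N = a at hd
  subst hd
  have hμ := hT.isNuPath
  have hbox := hT.recordingLabel_iff
  have hpts := hT.leftFlush_eq
  refine ⟨NuTree.rowPath (fun i => NuTree.rowCard T i - 1) a,
    fun μ' => ⟨fun h => ?_, ?_⟩, fun μ' => ⟨fun h => ?_, ?_⟩⟩
  · exact NuTree.eq_of_isBoxAbove_iff (h.1.1.trans hμ.1.symm) (h.1.2.1.trans hμ.2.1.symm)
      fun k c => (h.2 k c).trans (hbox k c)
  · rintro rfl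
    exact ⟨hμ, fun k c => (hbox k c).symm⟩
  · exact NuTree.eq_of_points_eq (h.1.1.trans hμ.1.symm) (h.1.2.1.trans hμ.2.1.symm)
      (h.2.trans hpts)
  · rintro rfl
    exact ⟨hμ, hpts.symm⟩
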